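/- Let $x=x[k]$ and $y=x[k+1]$ be unit vectors in $\mathbb C^n$, representing the points $[x],[y]$ of the Grassmann manifold $G_{n,1}$ of complex lines in $\mathbb C^n$ (unit vectors modulo $x\sim ux$, $|u|=1$). A tangent vector of $G_{n,1}$ at $[x]$ is represented by a vector $v$ at $x$ with $x^*v=0$, where $(x,v)$ and $(ux,uv)$ with $|u|=1$ represent the same tangent vector; its norm is $\|v\|$, and $G_{n,1}$ carries the Levi-Civita connection of this Riemannian metric. Put $\rho=x^*y$ and $d=\sqrt{1-|\rho|^2}$, and assume $\rho\neq 0$. Let $e$ be the tangent vector emanating from $[x]$ to $[y]$, that is, the initial velocity of the shortest geodesic $\gamma:[0,1]\to G_{n,1}$ from $[x]$ to $[y]$ (it is uniquely determined). Then the parallel transport of $e$ along $\gamma$ to $[y]$ is the tangent vector at $[y]$ represented, at the unit vector $\frac{\rho^*}{|\rho|}\,y$ of the line $[y]$, by $$\hat e=\arctan\!\left(\frac{d}{|\rho|}\right)\frac{y\rho^*-x}{d},$$ where the right-hand side is read as $0$ if $d=0$ (that is, if $[x]=[y]$). In particular $\hat e$ is represented by this formula at $y$ itself when the representatives are chosen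 with $\rho>0$. -/

import Mathlib

open scoped ComplexConjugate

noncomputable section

/-- The space `ℂⁿ` with its standard Hermitian inner product `x^* y = inner ℂ x y`. -/
abbrev CVec (n : ℕ) : Type := EuclideanSpace ℂ (Fin n)

/-- The Grassmann manifold `G_{n,1}` of complex lines in `ℂⁿ`. -/
abbrev Gr1 (n : ℕ) : Type := Projectivization ℂ (CVec n)

/-- Unit vectors of `ℂⁿ`, the representatives of points of `G_{n,1}`. -/
abbrev UnitVec (n : ℕ) : Type := Metric.sphere (0 : CVec n) 1

/-- The point of `G_{n,1}` represented by a unit vector. -/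
def UnitVec.line {n : ℕ} (x : UnitVec n) : Gr1 n :=
  Projectivization.mk ℂ (x : CVec n) (ne_zero_of_mem_unit_sphere x)

/-- A horizontal vector: a vector `vec` at the unit vector `base`, tangent to the unit sphere and
orthogonal to the circle `{u • base}`; that is, `base^* vec = 0`. -/
structure HorizVec (n : ℕ) where
  base : UnitVec n
  vec : CVec n
  orth : inner ℂ (base : CVec n) vec = 0

/-- Horizontal vectors `(x, v)` and `(u x, u v)`, with `|u| = 1`, represent the same tangent vector
of `G_{n,1}`. -/
instance HorizVec.setoid (n : ℕ) : Setoid (HorizVec n) where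
  r ξ η := ∃ u : ℂ, ‖u‖ = 1 ∧ (η.base : CVec n) = u • (ξ.base : CVec n) ∧ η.vec = u • ξ.vec
  iseqv :=
    { refl := fun ξ => ⟨1, by simp, by simp, by simp⟩
      symm := by
        rintro ξ η ⟨u, hu, h1, h2⟩
        have hu0 : u ≠ 0 := by
          rintro rfl
          simp at hu
        refine ⟨u⁻¹, by simp [hu], ?_, ?_⟩
        · rw [h1, inv_smul_smul₀ hu0]
        · rw [h2, inv_smul_smul₀ hu0]
      trans := by
        rintro ξ η ζ ⟨u, hu, h1, h2⟩ ⟨w, hw, h3, h4⟩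
        refine ⟨w * u, by simp [hu, hw], ?_, ?_⟩
        · rw [h3, h1, smul_smul]
        · rw [h4, h2, smul_smul] }

/-- The tangent bundle of `G_{n,1}`: horizontal vectors modulo common phases. -/
def TGr1 (n : ℕ) : Type := Quotient (HorizVec.setoid n)

/-- The tangent vector of `G_{n,1}` represented by a horizontal vector. -/
def HorizVec.toTangent {n : ℕ} (ξ : HorizVec n) : TGr1 n := Quotient.mk _ ξ

/-- The base point of a tangent vector of `G_{n,1}`. -/
def TGr1.proj {n : ℕ} (X : TGr1 n) : Gr1 n :=
  Quotient.lift (fun ξ : HorizVec n => ξ.base.line)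
    (by
      rintro ξ η ⟨u, _, h1, _⟩
      exact ((Projectivization.mk_eq_mk_iff' ℂ _ _ _ _).2 ⟨u, h1.symm⟩).symm) X

/-- The Riemannian norm of a tangent vector of `G_{n,1}`: the metric is the one that makes
`x ↦ x.line` a Riemannian submersion from the unit sphere of `ℂⁿ`. -/
def TGr1.norm {n : ℕ} (X : TGr1 n) : ℝ :=
  Quotient.lift (fun ξ : HorizVec n => ‖ξ.vec‖)
    (by
      rintro ξ η ⟨u, hu, _, h2⟩
      simp [h2, norm_smul, hu]) X

/-- `c : [0,1] → S^{2n-1}` is a `C¹` curve with derivative `c'` which is horizontal, i.e.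
`c(t)^* c'(t) = 0`. -/
def IsHorizontalCurve {n : ℕ} (c : ℝ → UnitVec n) (c' : ℝ → CVec n) : Prop :=
  ContinuousOn c' (Set.Icc 0 1) ∧
    ∀ t ∈ Set.Icc (0 : ℝ) 1,
      HasDerivWithinAt (fun s => (c s : CVec n)) (c' t) (Set.Icc 0 1) t ∧
        inner ℂ (c t : CVec n) (c' t) = 0

/-- `γ : [0,1] → G_{n,1}` is a `C¹` curve with velocity field `V`. Every `C¹` curve in `G_{n,1}` has
a `C¹` horizontal lift `c` to the unit sphere, unique up to a constant phase; the velocity at `t`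
is the tangent vector represented by `c'(t)` at `c(t)`. -/
def HasVelocityField {n : ℕ} (γ : ℝ → Gr1 n) (V : ℝ → TGr1 n) : Prop :=
  ∃ (c : ℝ → UnitVec n) (c' : ℝ → CVec n), IsHorizontalCurve c c' ∧
    ∀ t ∈ Set.Icc (0 : ℝ) 1, (c t).line = γ t ∧
      ∃ ξ : HorizVec n, ξ.base = c t ∧ ξ.vec = c' t ∧ V t = ξ.toTangent

/-- `X` is a parallel vector field along the `C¹` curve `γ : [0,1] → G_{n,1}`: its covariant
derivative (Levi-Civita connection) vanishes. Here `γ` is lifted to a horizontal curve `c` of unit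
vectors and `X` to the horizontal field `v` along `c`; the covariant derivative is then represented
by the horizontal part `v' - c (c^* v')` of the ordinary derivative `v'`. -/
def IsParallelAlong {n : ℕ} (γ : ℝ → Gr1 n) (X : ℝ → TGr1 n) : Prop :=
  ∃ (ξ : ℝ → HorizVec n) (c' v' : ℝ → CVec n),
    IsHorizontalCurve (fun t => (ξ t).base) c' ∧
    ∀ t ∈ Set.Icc (0 : ℝ) 1,
      (ξ t).base.line = γ t ∧ X t = (ξ t).toTangent ∧
      HasDerivWithinAt (fun s => (ξ s).vec) (v' t) (Set.Icc 0 1) t ∧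
      v' t - inner ℂ ((ξ t).base : CVec n) (v' t) • ((ξ t).base : CVec n) = 0

/-- `f` is the parallel transport of `e` from `γ 0` to `γ 1` along `γ`. -/
def IsParallelTransport {n : ℕ} (γ : ℝ → Gr1 n) (e f : TGr1 n) : Prop :=
  ∃ X : ℝ → TGr1 n, IsParallelAlong γ X ∧ X 0 = e ∧ X 1 = f

/-- The length of a curve on `[0,1]` with velocity field `V`. -/
def curveLength {n : ℕ} (V : ℝ → TGr1 n) : ℝ := ∫ t in (0 : ℝ)..1, (V t).norm

/-- `γ : [0,1] → G_{n,1}`, with velocity field `V`, is a geodesic from `p` to `q` (its velocity is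
parallel along it), and a shortest one among all `C¹` curves from `p` to `q`. -/
def IsShortestGeodesic {n : ℕ} (p q : Gr1 n) (γ : ℝ → Gr1 n) (V : ℝ → TGr1 n) : Prop :=
  HasVelocityField γ V ∧ IsParallelAlong γ V ∧ γ 0 = p ∧ γ 1 = q ∧
    ∀ (δ : ℝ → Gr1 n) (W : ℝ → TGr1 n), HasVelocityField δ W → δ 0 = p → δ 1 = q →
      curveLength V ≤ curveLength W

/-- `e` is a tangent vector emanating from `p` to `q`: the initial velocity of a shortest geodesic
`[0,1] → G_{n,1}` from `p` to `q`. -/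
def IsTangentFromTo {n : ℕ} (p q : Gr1 n) (e : TGr1 n) : Prop :=
  ∃ (γ : ℝ → Gr1 n) (V : ℝ → TGr1 n), IsShortestGeodesic p q γ V ∧ V 0 = e

end

noncomputable section

open Set

/-! Everything is lifted to the unit sphere, where horizontal lifts are unique up to a constant
phase (`IsHorizontalCurve.exists_phase`). If the velocity is parallel, the lift `b` has `b' = v`
with `v'` a multiple of `b`; differentiating `b^* v = 0` gives `v' = -ω² b`, so the lift is a great
circle of speed `ω` (`exists_isGeodesicLift`) and `b(0)^* b(1) = cos ω`.

Any curve between the lines has length at least `arccos |ρ|`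
(`HasVelocityField.arccos_le_curveLength`), and an explicit great circle attains this. A shortest
geodesic thus has `ω ≤ arccos |ρ| ≤ π/2`, which forces `cos ω = |ρ|` and the endpoint `(ρ^*/|ρ|) y`.
Its end velocity is `(ω / sin ω) (cos ω b(1) - b(0))`, which is the claimed formula since `sin ω =
d`. The velocity is itself parallel, so by uniqueness of parallel transport
(`IsParallelAlong.eq_one_of_eq_zero`) it is the transport of `e`. -/

theorem eq_of_hasDerivWithinAt_zero {F : Type*} [NormedAddCommGroup F] [NormedSpace ℝ F]
    {f : ℝ → F} (h : ∀ t ∈ Icc (0 : ℝ) 1, HasDerivWithinAt f 0 (Icc 0 1) t) :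
    ∀ t ∈ Icc (0 : ℝ) 1, f t = f 0 := by
  refine constant_of_has_deriv_right_zero (fun t ht => (h t ht).continuousWithinAt) ?_
  intro t ht
  exact (h t ⟨ht.1, ht.2.le⟩).mono_of_mem_nhdsWithin (Icc_mem_nhdsGE_of_mem ht)

/-! ### Phases acting on unit vectors and on horizontal vectors. -/

namespace UnitVec

variable {n : ℕ}

@[simp] theorem norm_coe (x : UnitVec n) : ‖(x : CVec n)‖ = 1 := norm_eq_of_mem_sphere x

@[simp] theorem inner_self (x : UnitVec n) : inner ℂ (x : CVec n) (x : CVec n) = 1 := by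
  rw [inner_self_eq_norm_sq_to_K, norm_coe]; simp

theorem coe_ne_zero (x : UnitVec n) : (x : CVec n) ≠ 0 := ne_zero_of_mem_unit_sphere x

theorem smul_coe_injective (x : UnitVec n) {u w : ℂ}
    (h : u • (x : CVec n) = w • (x : CVec n)) : u = w :=
  smul_left_injective ℂ x.coe_ne_zero h

/-- The unit vector `u x` for a phase `u`. -/
def rotate (u : ℂ) (hu : ‖u‖ = 1) (x : UnitVec n) : UnitVec n :=
  ⟨u • (x : CVec n), by simp [norm_smul, hu]⟩

@[simp] theorem coe_rotate (u : ℂ) (hu : ‖u‖ = 1) (x : UnitVec n) :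
    (rotate u hu x : CVec n) = u • (x : CVec n) := rfl

theorem line_eq_line_iff {x y : UnitVec n} :
    x.line = y.line ↔ ∃ u : ℂ, ‖u‖ = 1 ∧ (x : CVec n) = u • (y : CVec n) := by
  unfold line
  rw [Projectivization.mk_eq_mk_iff']
  constructor
  · rintro ⟨u, hu⟩
    refine ⟨u, ?_, hu.symm⟩
    have := congrArg norm hu
    simpa [norm_smul] using this
  · rintro ⟨u, -, hu⟩
    exact ⟨u, hu.symm⟩

@[simp] theorem line_rotate (u : ℂ) (hu : ‖u‖ = 1) (x : UnitVec n) :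
    (rotate u hu x).line = x.line :=
  line_eq_line_iff.2 ⟨u, hu, rfl⟩

end UnitVec

namespace HorizVec

variable {n : ℕ}

/-- The horizontal vector `(u x, u v)` for a phase `u`. -/
def rotate (u : ℂ) (hu : ‖u‖ = 1) (ξ : HorizVec n) : HorizVec n where
  base := ξ.base.rotate u hu
  vec := u • ξ.vec
  orth := by rw [UnitVec.coe_rotate, inner_smul_left, inner_smul_right, ξ.orth]; simp

theorem toTangent_eq_iff {ξ η : HorizVec n} : ξ.toTangent = η.toTangent ↔
    ∃ u : ℂ, ‖u‖ = 1 ∧ (η.base : CVec n) = u • (ξ.base : CVec n) ∧ η.vec = u • ξ.vec :=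
  Quotient.eq (r := HorizVec.setoid n)

@[simp] theorem toTangent_rotate (u : ℂ) (hu : ‖u‖ = 1) (ξ : HorizVec n) :
    (ξ.rotate u hu).toTangent = ξ.toTangent :=
  (toTangent_eq_iff.2 ⟨u, hu, rfl, rfl⟩).symm

theorem ext_of_coe {ξ η : HorizVec n} (h : (ξ.base : CVec n) = η.base) (h' : ξ.vec = η.vec) :
    ξ = η := by
  obtain ⟨b, v, _⟩ := ξ
  obtain ⟨b', v', _⟩ := η
  obtain rfl : b = b' := Subtype.ext h
  obtain rfl : v = v' := h'
  rfl

end HorizVec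

/-! ### Horizontal lifts, their length, and uniqueness of parallel transport. -/

theorem hasDerivWithinAt_Icc_unique {F : Type*} [NormedAddCommGroup F] [NormedSpace ℝ F]
    {f : ℝ → F} {a b : F} {t : ℝ} (ht : t ∈ Icc (0 : ℝ) 1)
    (ha : HasDerivWithinAt f a (Icc 0 1) t) (hb : HasDerivWithinAt f b (Icc 0 1) t) : a = b :=
  (uniqueDiffOn_Icc zero_lt_one t ht).eq_deriv _ ha hb

/-- Two horizontal lifts of the same curve differ by a constant phase. -/
theorem IsHorizontalCurve.exists_phase {n : ℕ} {b c : ℝ → UnitVec n} {b' c' : ℝ → CVec n}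
    (hb : IsHorizontalCurve b b') (hc : IsHorizontalCurve c c')
    (h : ∀ t ∈ Icc (0 : ℝ) 1, (c t).line = (b t).line) :
    ∃ u : ℂ, ‖u‖ = 1 ∧ ∀ t ∈ Icc (0 : ℝ) 1,
      (c t : CVec n) = u • (b t : CVec n) ∧ c' t = u • b' t := by
  have hph : ∀ t ∈ Icc (0 : ℝ) 1, ‖inner ℂ (b t : CVec n) (c t : CVec n)‖ = 1 ∧
      (c t : CVec n) = inner ℂ (b t : CVec n) (c t : CVec n) • (b t : CVec n) := by
    intro t ht
    obtain ⟨u, hu, hcu⟩ := UnitVec.line_eq_line_iff.1 (h t ht)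
    have : inner ℂ (b t : CVec n) (c t : CVec n) = u := by
      rw [hcu, inner_smul_right]; simp
    exact ⟨by rw [this, hu], by rw [this]; exact hcu⟩
  -- The phase is `b^* c`. Since `c` is a multiple of `b`, horizontality of both lifts kills both
  -- terms of its derivative.
  have hconst := eq_of_hasDerivWithinAt_zero
    (f := fun t => inner ℂ (b t : CVec n) (c t : CVec n)) (by
      intro t ht
      have := (hb.2 t ht).1.inner ℂ (hc.2 t ht).1
      have h1 : inner ℂ (b t : CVec n) (c' t) = 0 := by
        obtain ⟨u, hu, hcu⟩ := UnitVec.line_eq_line_iff.1 (h t ht).symm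
        rw [hcu, inner_smul_left, (hc.2 t ht).2, mul_zero]
      have h2 : inner ℂ (b' t) (c t : CVec n) = 0 := by
        rw [(hph t ht).2, inner_smul_right, inner_eq_zero_symm.1 (hb.2 t ht).2, mul_zero]
      rw [h1, h2, add_zero] at this
      exact this)
  have h0 : (0 : ℝ) ∈ Icc (0 : ℝ) 1 := by simp
  set u := inner ℂ (b 0 : CVec n) (c 0 : CVec n)
  have key : ∀ t ∈ Icc (0 : ℝ) 1, (c t : CVec n) = u • (b t : CVec n) := by
    intro t ht
    have := (hph t ht).2
    rwa [hconst t ht] at this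
  refine ⟨u, (hph 0 h0).1, fun t ht => ⟨key t ht, ?_⟩⟩
  refine hasDerivWithinAt_Icc_unique ht (hc.2 t ht).1 ?_
  exact ((hb.2 t ht).1.const_smul u).congr key (key t ht)

/-- The length of a horizontal curve on the unit sphere is at least the angle between its
endpoints. -/
theorem IsHorizontalCurve.arccos_le_integral {n : ℕ} {c : ℝ → UnitVec n} {c' : ℝ → CVec n}
    (hc : IsHorizontalCurve c c') :
    Real.arccos (inner ℂ (c 0 : CVec n) (c 1 : CVec n)).re ≤ ∫ t in (0 : ℝ)..1, ‖c' t‖ := by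
  set h : ℝ → ℝ := fun t => (inner ℂ (c 0 : CVec n) (c t : CVec n)).re with hh
  have hder : ∀ t ∈ Icc (0 : ℝ) 1,
      HasDerivWithinAt h (inner ℂ (c 0 : CVec n) (c' t)).re (Icc 0 1) t := by
    intro t ht
    have h1 := (hasDerivWithinAt_const t (Icc (0 : ℝ) 1) (c 0 : CVec n)).inner ℂ (hc.2 t ht).1
    have h2 := Complex.reCLM.hasFDerivAt.comp_hasDerivWithinAt t h1
    exact h2.congr_deriv (by simp)
  have habs : ∀ t, |h t| ≤ 1 := by
    intro t
    have h1 := norm_inner_le_norm (𝕜 := ℂ) (c 0 : CVec n) (c t : CVec n)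
    simp only [UnitVec.norm_coe, mul_one] at h1
    exact (Complex.abs_re_le_norm _).trans h1
  -- As `c' t` is orthogonal to `c t`, a multiple of `c t` may be subtracted from `c 0` before
  -- applying Cauchy-Schwarz.
  have hbound : ∀ t ∈ Icc (0 : ℝ) 1,
      |(inner ℂ (c 0 : CVec n) (c' t)).re| ≤ √(1 - h t ^ 2) * ‖c' t‖ := by
    intro t ht
    have h1 : (inner ℂ (c 0 : CVec n) (c' t)) =
        inner ℂ ((c 0 : CVec n) - (h t : ℂ) • (c t : CVec n)) (c' t) := by
      rw [inner_sub_left, inner_smul_left, (hc.2 t ht).2, mul_zero, sub_zero]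
    have h2 : ‖(c 0 : CVec n) - (h t : ℂ) • (c t : CVec n)‖ = √(1 - h t ^ 2) := by
      rw [← Real.sqrt_sq (norm_nonneg _), norm_sub_sq (𝕜 := ℂ), inner_smul_right]
      congr 1
      have : (inner ℂ (c 0 : CVec n) (c t : CVec n)).re = h t := rfl
      simp [norm_smul, this]
      ring
    rw [h1, ← h2]
    exact (Complex.abs_re_le_norm _).trans (norm_inner_le_norm _ _)
  -- `arcsin` is not differentiable at `±1`, and `h 0 = 1`. Scaling by `k < 1` avoids these points;
  -- afterwards `k` tends to `1`.
  have hk : ∀ k : ℝ, k ∈ Ioo (0 : ℝ) 1 →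
      Real.arcsin (k * h 0) - Real.arcsin (k * h 1) ≤ ∫ t in (0 : ℝ)..1, ‖c' t‖ := by
    intro k hk
    have hlt : ∀ t, |k * h t| < 1 := by
      intro t
      rw [abs_mul, abs_of_pos hk.1]
      calc k * |h t| ≤ k * 1 := by gcongr; exacts [hk.1.le, habs t]
        _ < 1 := by linarith [hk.2]
    have hd : ∀ t ∈ Icc (0 : ℝ) 1, HasDerivWithinAt (fun t => -Real.arcsin (k * h t))
        (-(1 / √(1 - (k * h t) ^ 2) * (k * (inner ℂ (c 0 : CVec n) (c' t)).re)))
        (Icc 0 1) t := by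
      intro t ht
      have h1 := abs_lt.1 (hlt t)
      exact ((Real.hasDerivAt_arcsin h1.1.ne' h1.2.ne).comp_hasDerivWithinAt t
        ((hder t ht).const_mul k)).neg
    have := intervalIntegral.sub_le_integral_of_hasDeriv_right_of_le (φ := fun t => ‖c' t‖)
      zero_le_one (fun t ht => (hd t ht).continuousWithinAt)
      (fun t ht => ((hd t ⟨ht.1.le, ht.2.le⟩).hasDerivAt
        (Icc_mem_nhds ht.1 ht.2)).hasDerivWithinAt)
      (hc.1.norm.integrableOn_compact isCompact_Icc) ?_
    · linarith
    · intro t ht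
      have h1 := hbound t ⟨ht.1.le, ht.2.le⟩
      have hle : h t ^ 2 ≤ 1 := (sq_le_one_iff_abs_le_one _).2 (habs t)
      have hpos : 0 < 1 - (k * h t) ^ 2 := by
        have := (sq_lt_one_iff_abs_lt_one _).2 (hlt t)
        linarith
      have hs : k * √(1 - h t ^ 2) ≤ √(1 - (k * h t) ^ 2) := by
        apply Real.le_sqrt_of_sq_le
        rw [mul_pow, Real.sq_sqrt (by linarith)]
        nlinarith [hk.1, hk.2]
      have hsp := Real.sqrt_pos.2 hpos
      refine (neg_le_abs _).trans ?_
      rw [abs_mul, abs_mul, abs_of_pos hk.1, abs_of_pos (by positivity), one_div,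
        inv_mul_le_iff₀ hsp]
      calc k * |(inner ℂ (c 0 : CVec n) (c' t)).re|
          ≤ k * (√(1 - h t ^ 2) * ‖c' t‖) := by gcongr; exact hk.1.le
        _ = k * √(1 - h t ^ 2) * ‖c' t‖ := by ring
        _ ≤ _ := by gcongr
  have hlim : Filter.Tendsto (fun k : ℝ => Real.arcsin (k * h 0) - Real.arcsin (k * h 1))
      (nhdsWithin 1 (Iio 1)) (nhds (Real.arcsin (1 * h 0) - Real.arcsin (1 * h 1))) := by
    apply tendsto_nhdsWithin_of_tendsto_nhds
    apply Continuous.tendsto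
    fun_prop
  have hle := le_of_tendsto hlim (Filter.mem_of_superset (Ioo_mem_nhdsLT zero_lt_one) hk)
  have h0 : h 0 = 1 := by simp [hh]
  rw [h0, one_mul, one_mul, Real.arcsin_one] at hle
  exact hle

/-- A field orthogonal to `b` whose derivative is a multiple of `b` has constant norm. -/
theorem inner_self_eq_of_hasDerivWithinAt_smul {n : ℕ} {b : ℝ → UnitVec n} {v : ℝ → CVec n}
    {r : ℝ → ℂ} (horth : ∀ t ∈ Icc (0 : ℝ) 1, inner ℂ (b t : CVec n) (v t) = 0)
    (hv : ∀ t ∈ Icc (0 : ℝ) 1, HasDerivWithinAt v (r t • (b t : CVec n)) (Icc 0 1) t) :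
    ∀ t ∈ Icc (0 : ℝ) 1, inner ℂ (v t) (v t) = inner ℂ (v 0) (v 0) := by
  refine eq_of_hasDerivWithinAt_zero (f := fun t => inner ℂ (v t) (v t)) fun t ht => ?_
  have := (hv t ht).inner ℂ (hv t ht)
  rw [inner_smul_left, inner_smul_right, horth t ht, inner_eq_zero_symm.1 (horth t ht),
    mul_zero, mul_zero, add_zero] at this
  exact this

/-- Once the two lifts are matched by a constant phase, the difference of the fields is again
horizontal with vertical derivative. Its norm is therefore constant, and it is zero at the start. -/
theorem IsParallelAlong.eq_one_of_eq_zero {n : ℕ} {γ : ℝ → Gr1 n} {X Y : ℝ → TGr1 n}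
    (hX : IsParallelAlong γ X) (hY : IsParallelAlong γ Y) (h0 : X 0 = Y 0) : X 1 = Y 1 := by
  obtain ⟨ξ, b', v', hb, hξ⟩ := hX
  obtain ⟨η, c', w', hc, hη⟩ := hY
  have m0 : (0 : ℝ) ∈ Icc (0 : ℝ) 1 := by simp
  have m1 : (1 : ℝ) ∈ Icc (0 : ℝ) 1 := by simp
  obtain ⟨u, hu, hphase⟩ := hb.exists_phase hc
    (fun t ht => (hη t ht).1.trans (hξ t ht).1.symm)
  rw [(hξ 0 m0).2.1, (hη 0 m0).2.1, HorizVec.toTangent_eq_iff] at h0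
  obtain ⟨w, -, hw1, hw2⟩ := h0
  obtain rfl : u = w := (ξ 0).base.smul_coe_injective ((hphase 0 m0).1.symm.trans hw1)
  have key := inner_self_eq_of_hasDerivWithinAt_smul (b := fun t => (ξ t).base)
    (v := fun t => (η t).vec - u • (ξ t).vec)
    (r := fun t => inner ℂ ((η t).base : CVec n) (w' t) * u -
      u * inner ℂ ((ξ t).base : CVec n) (v' t))
    (by
      intro t ht
      have hu0 : u ≠ 0 := by rintro rfl; simp at hu
      have h1 := (η t).orth
      rw [(hphase t ht).1, inner_smul_left, mul_eq_zero] at h1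
      rw [inner_sub_right, inner_smul_right, (ξ t).orth, h1.resolve_left (by simpa using hu0)]
      simp)
    (by
      intro t ht
      have h1 := (hη t ht).2.2.1.sub ((hξ t ht).2.2.1.const_smul u)
      refine h1.congr_deriv ?_
      rw [sub_smul, mul_smul, mul_smul, ← (hphase t ht).1, ← sub_eq_zero.1 (hη t ht).2.2.2,
        ← sub_eq_zero.1 (hξ t ht).2.2.2])
    1 m1
  simp only [hw2, sub_self, inner_zero_left] at key
  rw [(hξ 1 m1).2.1, (hη 1 m1).2.1, HorizVec.toTangent_eq_iff]
  exact ⟨u, hu, (hphase 1 m1).1, sub_eq_zero.1 (inner_self_eq_zero.1 key)⟩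

/-! ### Geodesics as projections of great circles. -/

/-- `ξ` is the lift of a geodesic of constant speed `ω`: a great circle on the unit sphere,
together with its velocity. -/
structure IsGeodesicLift {n : ℕ} (ξ : ℝ → HorizVec n) (ω : ℝ) : Prop where
  nonneg : 0 ≤ ω
  norm_vec : ∀ t ∈ Icc (0 : ℝ) 1, ‖(ξ t).vec‖ = ω
  deriv_base : ∀ t ∈ Icc (0 : ℝ) 1,
    HasDerivWithinAt (fun s => ((ξ s).base : CVec n)) (ξ t).vec (Icc 0 1) t
  deriv_vec : ∀ t ∈ Icc (0 : ℝ) 1,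
    HasDerivWithinAt (fun s => (ξ s).vec) (-(ω ^ 2) • ((ξ t).base : CVec n)) (Icc 0 1) t

theorem IsGeodesicLift.rotate {n : ℕ} {ξ : ℝ → HorizVec n} {ω : ℝ} (h : IsGeodesicLift ξ ω)
    (u : ℂ) (hu : ‖u‖ = 1) : IsGeodesicLift (fun t => (ξ t).rotate u hu) ω where
  nonneg := h.nonneg
  norm_vec t ht := by
    change ‖u • (ξ t).vec‖ = ω
    rw [norm_smul, hu, one_mul, h.norm_vec t ht]
  deriv_base t ht := (h.deriv_base t ht).const_smul u
  deriv_vec t ht := by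
    refine ((h.deriv_vec t ht).const_smul u).congr_deriv ?_
    exact (smul_comm _ _ _)

theorem exists_isGeodesicLift {n : ℕ} {γ : ℝ → Gr1 n} {V : ℝ → TGr1 n} (hV : HasVelocityField γ V)
    (hp : IsParallelAlong γ V) {x : UnitVec n} (hx : γ 0 = x.line) :
    ∃ (ξ : ℝ → HorizVec n) (ω : ℝ), IsGeodesicLift ξ ω ∧ (ξ 0).base = x ∧
      ∀ t ∈ Icc (0 : ℝ) 1, (ξ t).base.line = γ t ∧ V t = (ξ t).toTangent := by
  obtain ⟨c, c', hc, hcV⟩ := hV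
  obtain ⟨ξ, b', v', hb, hξ⟩ := hp
  have m0 : (0 : ℝ) ∈ Icc (0 : ℝ) 1 := by simp
  obtain ⟨u, hu, hphase⟩ := hb.exists_phase hc
    (fun t ht => (hcV t ht).1.trans (hξ t ht).1.symm)
  have hu0 : u ≠ 0 := by rintro rfl; simp at hu
  have hvel : ∀ t ∈ Icc (0 : ℝ) 1, b' t = (ξ t).vec := by
    intro t ht
    obtain ⟨ζ, hζ1, hζ2, hζ3⟩ := (hcV t ht).2
    obtain ⟨w, -, hw1, hw2⟩ := HorizVec.toTangent_eq_iff.1 ((hξ t ht).2.1.symm.trans hζ3)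
    rw [hζ1, (hphase t ht).1] at hw1
    obtain rfl : u = w := (ξ t).base.smul_coe_injective hw1
    rw [hζ2, (hphase t ht).2] at hw2
    exact smul_right_injective _ hu0 hw2
  have hbase : ∀ t ∈ Icc (0 : ℝ) 1,
      HasDerivWithinAt (fun s => ((ξ s).base : CVec n)) (ξ t).vec (Icc 0 1) t := by
    intro t ht
    rw [← hvel t ht]
    exact (hb.2 t ht).1
  have hvec : ∀ t ∈ Icc (0 : ℝ) 1, HasDerivWithinAt (fun s => (ξ s).vec)
      (inner ℂ ((ξ t).base : CVec n) (v' t) • ((ξ t).base : CVec n)) (Icc 0 1) t := by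
    intro t ht
    rw [← sub_eq_zero.1 (hξ t ht).2.2.2]
    exact (hξ t ht).2.2.1
  have hnorm := inner_self_eq_of_hasDerivWithinAt_smul (b := fun t => (ξ t).base)
    (v := fun t => (ξ t).vec) (fun t _ => (ξ t).orth) hvec
  have hnorm' : ∀ t ∈ Icc (0 : ℝ) 1, ‖(ξ t).vec‖ = ‖(ξ 0).vec‖ := by
    intro t ht
    have h1 := hnorm t ht
    simp only [inner_self_eq_norm_sq_to_K] at h1
    exact (sq_eq_sq₀ (norm_nonneg _) (norm_nonneg _)).1 (by exact_mod_cast h1)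
  have hlift : IsGeodesicLift ξ ‖(ξ 0).vec‖ :=
    { nonneg := norm_nonneg _
      norm_vec := hnorm'
      deriv_base := hbase
      deriv_vec := by
        intro t ht
        refine (hvec t ht).congr_deriv ?_
        -- Differentiating `b^* v = 0` gives `b^* v' = -‖v‖²`, the coefficient of the acceleration.
        have h1 := (hbase t ht).inner ℂ (hξ t ht).2.2.1
        simp only [HorizVec.orth] at h1
        have h2 := hasDerivWithinAt_Icc_unique ht h1 (hasDerivWithinAt_const _ _ _)
        rw [eq_neg_of_add_eq_zero_left h2, inner_self_eq_norm_sq_to_K, hnorm' t ht,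
          neg_smul, neg_smul]
        congr 1
        rw [← Complex.coe_smul]
        simp }
  have hx0 := (hξ 0 m0).1
  rw [hx] at hx0
  obtain ⟨w, hw, hxw⟩ := UnitVec.line_eq_line_iff.1 hx0.symm
  refine ⟨fun t => (ξ t).rotate w hw, _, hlift.rotate w hw, Subtype.ext hxw.symm, ?_⟩
  intro t ht
  refine ⟨(UnitVec.line_rotate w hw _).trans (hξ t ht).1, ?_⟩
  rw [HorizVec.toTangent_rotate]
  exact (hξ t ht).2.1

namespace IsGeodesicLift

variable {n : ℕ} {ξ : ℝ → HorizVec n} {ω : ℝ}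

theorem isHorizontalCurve (h : IsGeodesicLift ξ ω) :
    IsHorizontalCurve (fun t => (ξ t).base) (fun t => (ξ t).vec) :=
  ⟨fun t ht => (h.deriv_vec t ht).continuousWithinAt,
    fun t ht => ⟨h.deriv_base t ht, (ξ t).orth⟩⟩

theorem hasVelocityField (h : IsGeodesicLift ξ ω) :
    HasVelocityField (fun t => (ξ t).base.line) (fun t => (ξ t).toTangent) :=
  ⟨_, _, h.isHorizontalCurve, fun t _ => ⟨rfl, ξ t, rfl, rfl, rfl⟩⟩

theorem isParallelAlong (h : IsGeodesicLift ξ ω) :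
    IsParallelAlong (fun t => (ξ t).base.line) (fun t => (ξ t).toTangent) := by
  refine ⟨ξ, _, _, h.isHorizontalCurve, fun t ht => ⟨rfl, rfl, h.deriv_vec t ht, ?_⟩⟩
  rw [inner_smul_right_eq_smul, UnitVec.inner_self, sub_eq_zero, smul_assoc, one_smul]

theorem curveLength_eq (h : IsGeodesicLift ξ ω) {V : ℝ → TGr1 n}
    (hV : ∀ t ∈ Icc (0 : ℝ) 1, V t = (ξ t).toTangent) : curveLength V = ω := by
  have : ∀ t ∈ uIcc (0 : ℝ) 1, (V t).norm = ω := by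
    intro t ht
    rw [uIcc_of_le zero_le_one] at ht
    rw [hV t ht]
    exact h.norm_vec t ht
  rw [curveLength, intervalIntegral.integral_congr this]
  simp

/-- Rotating position and velocity back by the angle `ω t` gives a quantity constant in `t`. The
factor `ω` avoids a division when `ω = 0`. -/
theorem smul_base_zero (h : IsGeodesicLift ξ ω) :
    (ω * Real.cos ω) • ((ξ 1).base : CVec n) - Real.sin ω • (ξ 1).vec =
      ω • ((ξ 0).base : CVec n) := by
  have key := eq_of_hasDerivWithinAt_zero (f := fun t => (ω * Real.cos (ω * t)) •
    ((ξ t).base : CVec n) - Real.sin (ω * t) • (ξ t).vec) (by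
      intro t ht
      have hl : HasDerivWithinAt (fun t : ℝ => ω * t) ω (Icc 0 1) t := by
        simpa using (hasDerivWithinAt_id t (Icc (0 : ℝ) 1)).const_mul ω
      refine (((hl.cos.const_mul ω).smul (h.deriv_base t ht)).sub
        (hl.sin.smul (h.deriv_vec t ht))).congr_deriv ?_
      module) 1 (by simp)
  simpa using key

theorem vec_zero (h : IsGeodesicLift ξ ω) :
    (ω * Real.sin ω) • ((ξ 1).base : CVec n) + Real.cos ω • (ξ 1).vec = (ξ 0).vec := by
  have key := eq_of_hasDerivWithinAt_zero (f := fun t => (ω * Real.sin (ω * t)) •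
    ((ξ t).base : CVec n) + Real.cos (ω * t) • (ξ t).vec) (by
      intro t ht
      have hl : HasDerivWithinAt (fun t : ℝ => ω * t) ω (Icc 0 1) t := by
        simpa using (hasDerivWithinAt_id t (Icc (0 : ℝ) 1)).const_mul ω
      refine (((hl.sin.const_mul ω).smul (h.deriv_base t ht)).add
        (hl.cos.smul (h.deriv_vec t ht))).congr_deriv ?_
      module) 1 (by simp)
  simpa using key

theorem base_one (h : IsGeodesicLift ξ ω) :
    ω • ((ξ 1).base : CVec n) = (ω * Real.cos ω) • ((ξ 0).base : CVec n) +
      Real.sin ω • (ξ 0).vec := by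
  have e : ω • ((ξ 1).base : CVec n) =
      (ω * (Real.cos ω ^ 2 + Real.sin ω ^ 2)) • ((ξ 1).base : CVec n) := by
    rw [Real.cos_sq_add_sin_sq, mul_one]
  rw [e, ← h.vec_zero, mul_comm ω (Real.cos ω), mul_smul _ ω, ← h.smul_base_zero]
  module

theorem inner_base (h : IsGeodesicLift ξ ω) :
    inner ℂ ((ξ 0).base : CVec n) ((ξ 1).base : CVec n) = (Real.cos ω : ℂ) := by
  rcases eq_or_ne ω 0 with rfl | hω
  · have key := eq_of_hasDerivWithinAt_zero (f := fun t => ((ξ t).base : CVec n)) (by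
      intro t ht
      have := h.deriv_base t ht
      rwa [norm_eq_zero.1 (h.norm_vec t ht)] at this) 1 (by simp)
    rw [key]; simp
  · have h1 := congrArg (inner ℂ ((ξ 0).base : CVec n)) h.base_one
    rw [inner_add_right, inner_smul_right_eq_smul, inner_smul_right_eq_smul,
      inner_smul_right_eq_smul, (ξ 0).orth, UnitVec.inner_self, smul_zero, add_zero,
      mul_smul] at h1
    have h2 := smul_right_injective ℂ hω h1
    rw [h2]; simp

theorem vec_one_eq (h : IsGeodesicLift ξ ω) (hω : ω < Real.pi) :
    (ξ 1).vec = (ω / Real.sin ω) •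
      (Real.cos ω • ((ξ 1).base : CVec n) - ((ξ 0).base : CVec n)) := by
  rcases h.nonneg.eq_or_lt with rfl | hpos
  -- For `ω = 0` the velocity vanishes, and so does the coefficient `0 / sin 0`.
  · simpa using h.norm_vec 1 (by simp)
  · have hs := Real.sin_pos_of_pos_of_lt_pi hpos hω
    apply smul_right_injective _ hs.ne'
    simp only
    rw [smul_smul (Real.sin ω), mul_div_cancel₀ _ hs.ne', smul_sub]
    rw [← h.smul_base_zero]
    module

theorem vec_zero_eq (h : IsGeodesicLift ξ ω) (hω : ω < Real.pi) :
    (ξ 0).vec = (ω / Real.sin ω) •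
      (((ξ 1).base : CVec n) - Real.cos ω • ((ξ 0).base : CVec n)) := by
  rcases h.nonneg.eq_or_lt with rfl | hpos
  · simpa using h.norm_vec 0 (by simp)
  · have hs := Real.sin_pos_of_pos_of_lt_pi hpos hω
    apply smul_right_injective _ hs.ne'
    simp only
    rw [smul_smul (Real.sin ω), mul_div_cancel₀ _ hs.ne', smul_sub]
    rw [h.base_one]
    module

end IsGeodesicLift

/-! ### The distance between two lines and the great circle realizing it. -/

theorem UnitVec.norm_inner_eq_of_line_eq {n : ℕ} {x y x' y' : UnitVec n} (hx : x'.line = x.line)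
    (hy : y'.line = y.line) : ‖inner ℂ (x' : CVec n) (y' : CVec n)‖ =
      ‖inner ℂ (x : CVec n) (y : CVec n)‖ := by
  obtain ⟨u, hu, hxu⟩ := UnitVec.line_eq_line_iff.1 hx
  obtain ⟨w, hw, hyw⟩ := UnitVec.line_eq_line_iff.1 hy
  rw [hxu, hyw, inner_smul_left, inner_smul_right]
  simp [hu, hw]

/-- The distance between two complex lines bounds the length of a curve from below. -/
theorem HasVelocityField.arccos_le_curveLength {n : ℕ} {δ : ℝ → Gr1 n} {W : ℝ → TGr1 n}
    (h : HasVelocityField δ W) {x y : UnitVec n} (hx : δ 0 = x.line) (hy : δ 1 = y.line) :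
    Real.arccos ‖inner ℂ (x : CVec n) (y : CVec n)‖ ≤ curveLength W := by
  obtain ⟨c, c', hc, hcW⟩ := h
  have hlen : curveLength W = ∫ t in (0 : ℝ)..1, ‖c' t‖ := by
    refine intervalIntegral.integral_congr fun t ht => ?_
    rw [uIcc_of_le zero_le_one] at ht
    obtain ⟨ξ, -, hξ, hW⟩ := (hcW t ht).2
    rw [hW, ← hξ]
    rfl
  rw [hlen, ← UnitVec.norm_inner_eq_of_line_eq ((hcW 0 (by simp)).1.trans hx)
    ((hcW 1 (by simp)).1.trans hy)]
  exact (Real.arccos_le_arccos (Complex.re_le_norm _)).trans hc.arccos_le_integral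

/-- The great circle with initial unit vector `x`, unit direction `e` and speed `ω`. -/
theorem exists_isGeodesicLift_of_inner_eq_zero {n : ℕ} (x : UnitVec n) (e : CVec n) {ω : ℝ}
    (hω : 0 ≤ ω) (hxe : inner ℂ (x : CVec n) e = 0) (he : ω = 0 ∨ ‖e‖ = 1) :
    ∃ ξ : ℝ → HorizVec n, IsGeodesicLift ξ ω ∧ (ξ 0).base = x ∧
      ((ξ 1).base : CVec n) = Real.cos ω • (x : CVec n) + Real.sin ω • e := by
  have hex : inner ℂ e (x : CVec n) = 0 := inner_eq_zero_symm.1 hxe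
  have hnorm : ∀ a b : ℝ, ‖a • (x : CVec n) + b • e‖ ^ 2 = a ^ 2 + b ^ 2 * ‖e‖ ^ 2 := by
    intro a b
    rw [norm_add_sq (𝕜 := ℂ), inner_smul_left_eq_smul, inner_smul_right_eq_smul, hxe]
    simp [norm_smul, mul_pow]
  -- When `ω = 0` the direction `e` need not be a unit vector, but its norm only enters multiplied
  -- by a factor that then vanishes.
  have hee : ∀ t, Real.sin (ω * t) ^ 2 * ‖e‖ ^ 2 = Real.sin (ω * t) ^ 2 := by
    intro t
    rcases he with rfl | he
    · simp
    · simp [he]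
  have hee' : ω * ‖e‖ ^ 2 = ω := by
    rcases he with rfl | he
    · simp
    · simp [he]
  let b : ℝ → UnitVec n := fun t =>
    ⟨Real.cos (ω * t) • (x : CVec n) + Real.sin (ω * t) • e, by
      rw [mem_sphere_zero_iff_norm, ← sq_eq_sq₀ (norm_nonneg _) zero_le_one, hnorm, hee,
        Real.cos_sq_add_sin_sq, one_pow]⟩
  let ξ : ℝ → HorizVec n := fun t =>
    { base := b t
      vec := (-(ω * Real.sin (ω * t))) • (x : CVec n) + (ω * Real.cos (ω * t)) • e
      orth := by
        change inner ℂ (Real.cos (ω * t) • (x : CVec n) + Real.sin (ω * t) • e) _ = 0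
        have h1 : (inner ℂ e e : ℂ) = ((‖e‖ ^ 2 : ℝ) : ℂ) := by
          rw [inner_self_eq_norm_sq_to_K]; simp
        simp only [inner_add_left, inner_add_right, inner_smul_left_eq_smul,
          inner_smul_right_eq_smul, hxe, hex, UnitVec.inner_self, h1, Complex.real_smul]
        have h2 : (ω : ℂ) * ((‖e‖ ^ 2 : ℝ) : ℂ) = ω := by exact_mod_cast hee'
        push_cast at h2 ⊢
        linear_combination Complex.sin (ω * t) * Complex.cos (ω * t) * h2 }
  refine ⟨ξ, ⟨hω, ?_, ?_, ?_⟩, ?_, ?_⟩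
  · intro t _
    change ‖(-(ω * Real.sin (ω * t))) • (x : CVec n) + (ω * Real.cos (ω * t)) • e‖ = ω
    rw [← sq_eq_sq₀ (norm_nonneg _) hω, hnorm]
    linear_combination ω ^ 2 * Real.sin_sq_add_cos_sq (ω * t) +
      ω * Real.cos (ω * t) ^ 2 * hee'
  · intro t _
    have hl : HasDerivWithinAt (fun t : ℝ => ω * t) ω (Icc 0 1) t := by
      simpa using (hasDerivWithinAt_id t (Icc (0 : ℝ) 1)).const_mul ω
    refine ((hl.cos.smul_const (x : CVec n)).add (hl.sin.smul_const e)).congr_deriv ?_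
    change _ = (-(ω * Real.sin (ω * t))) • (x : CVec n) + (ω * Real.cos (ω * t)) • e
    module
  · intro t _
    have hl : HasDerivWithinAt (fun t : ℝ => ω * t) ω (Icc 0 1) t := by
      simpa using (hasDerivWithinAt_id t (Icc (0 : ℝ) 1)).const_mul ω
    refine (((hl.sin.const_mul ω).neg.smul_const (x : CVec n)).add
      ((hl.cos.const_mul ω).smul_const e)).congr_deriv ?_
    change _ = -(ω ^ 2) • (Real.cos (ω * t) • (x : CVec n) + Real.sin (ω * t) • e)
    module
  · apply Subtype.ext
    simp [ξ, b]
  · simp [ξ, b]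

section Phase

variable {n : ℕ} {x y : UnitVec n} {ρ : ℂ}

theorem norm_conj_div_norm (hρ0 : ρ ≠ 0) : ‖conj ρ / (‖ρ‖ : ℂ)‖ = 1 := by
  simp [hρ0]

theorem conj_div_norm_mul_self (hρ0 : ρ ≠ 0) : conj ρ / (‖ρ‖ : ℂ) * ρ = (‖ρ‖ : ℂ) := by
  have h : (‖ρ‖ : ℂ) ≠ 0 := by simpa using hρ0
  rw [div_mul_eq_mul_div, div_eq_iff h, Complex.conj_mul', sq]

/-- A geodesic lift from `x` to a representative of `y` of length at most `π / 2` has the distance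
of the lines as its speed, and ends at the representative of `y` that is in phase with `x`. -/
theorem IsGeodesicLift.eq_arccos {ξ : ℝ → HorizVec n} {ω : ℝ} (h : IsGeodesicLift ξ ω)
    (hω : ω ≤ Real.pi / 2) (hρ : ρ = inner ℂ (x : CVec n) (y : CVec n)) (hρ0 : ρ ≠ 0)
    (hx : (ξ 0).base = x) (hy : (ξ 1).base.line = y.line) :
    ω = Real.arccos ‖ρ‖ ∧ ((ξ 1).base : CVec n) = (conj ρ / (‖ρ‖ : ℂ)) • (y : CVec n) := by
  obtain ⟨u, hu, hyu⟩ := UnitVec.line_eq_line_iff.1 hy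
  have h1 := h.inner_base
  rw [hx, hyu, inner_smul_right, ← hρ] at h1
  -- The bound `ω ≤ π / 2` makes `cos ω` nonnegative, which removes the sign ambiguity in `|cos ω| =
  -- |ρ|`.
  have hcos : Real.cos ω = ‖ρ‖ := by
    have h2 := congrArg norm h1
    rw [norm_mul, hu, one_mul, Complex.norm_real, Real.norm_of_nonneg
      (Real.cos_nonneg_of_neg_pi_div_two_le_of_le
        (by linarith [Real.pi_pos, h.nonneg]) hω)] at h2
    exact h2.symm
  refine ⟨?_, ?_⟩
  · rw [← hcos, Real.arccos_cos h.nonneg (by linarith [Real.pi_pos])]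
  · rw [hyu]
    congr 1
    apply mul_right_cancel₀ hρ0
    rw [h1, conj_div_norm_mul_self hρ0, hcos]

/-- The initial direction is the normalized component orthogonal to `x` of the representative of
`[y]` in phase with `x`; that component has norm `d`. -/
theorem exists_isGeodesicLift_arccos (hρ : ρ = inner ℂ (x : CVec n) (y : CVec n))
    (hρ0 : ρ ≠ 0) : ∃ ξ : ℝ → HorizVec n, IsGeodesicLift ξ (Real.arccos ‖ρ‖) ∧
      (ξ 0).base = x ∧ ((ξ 1).base : CVec n) = (conj ρ / (‖ρ‖ : ℂ)) • (y : CVec n) := by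
  have hle : ‖ρ‖ ≤ 1 := by
    rw [hρ]
    simpa using norm_inner_le_norm (𝕜 := ℂ) (x : CVec n) (y : CVec n)
  set u := conj ρ / (‖ρ‖ : ℂ) with hu
  set d := √(1 - ‖ρ‖ ^ 2) with hd
  set z : CVec n := u • (y : CVec n) - ‖ρ‖ • (x : CVec n) with hz
  have hxu : inner ℂ (x : CVec n) (u • (y : CVec n)) = (‖ρ‖ : ℂ) := by
    rw [inner_smul_right, ← hρ, hu, conj_div_norm_mul_self hρ0]
  have hcos : Real.cos (Real.arccos ‖ρ‖) = ‖ρ‖ :=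
    Real.cos_arccos (by linarith [norm_nonneg ρ]) hle
  have hsin : Real.sin (Real.arccos ‖ρ‖) = d := Real.sin_arccos _
  have hzn : ‖z‖ = d := by
    rw [← Real.sqrt_sq (norm_nonneg z), hd, hz, norm_sub_sq (𝕜 := ℂ), inner_smul_right_eq_smul,
      ← inner_conj_symm, hxu, norm_smul, hu, norm_conj_div_norm hρ0]
    congr 1
    simp [norm_smul]
    ring
  obtain ⟨ξ, h1, h2, h3⟩ := exists_isGeodesicLift_of_inner_eq_zero x (d⁻¹ • z)
    (Real.arccos_nonneg ‖ρ‖)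
    (by
      rw [inner_smul_right_eq_smul, hz, inner_sub_right, hxu, inner_smul_right_eq_smul]
      simp)
    (by
      -- If `d = 0`, then `sin (arccos |ρ|) = 0` with `arccos |ρ| ≤ π / 2`, so the speed is zero and
      -- no unit direction is needed.
      rcases eq_or_ne d 0 with h0 | h0
      · left
        by_contra hne
        have hpos := lt_of_le_of_ne (Real.arccos_nonneg ‖ρ‖) (Ne.symm hne)
        have hpi := Real.arccos_le_pi_div_two.2 (norm_nonneg ρ)
        have := Real.sin_pos_of_pos_of_lt_pi hpos (by linarith [Real.pi_pos])
        rw [hsin, h0] at this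
        exact lt_irrefl _ this
      · right
        rw [norm_smul, hzn, norm_inv, Real.norm_of_nonneg (Real.sqrt_nonneg _),
          inv_mul_cancel₀ h0])
  refine ⟨ξ, h1, h2, ?_⟩
  rw [h3, hcos, hsin]
  have hdz : d • d⁻¹ • z = z := by
    rcases eq_or_ne d 0 with h0 | h0
    · rw [norm_eq_zero.1 (hzn.trans h0)]; simp
    · rw [smul_inv_smul₀ h0]
  rw [hdz, hz]
  abel

theorem IsGeodesicLift.isShortestGeodesic {ξ : ℝ → HorizVec n}
    (h : IsGeodesicLift ξ (Real.arccos ‖inner ℂ (x : CVec n) (y : CVec n)‖))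
    (hx : (ξ 0).base.line = x.line) (hy : (ξ 1).base.line = y.line) :
    IsShortestGeodesic x.line y.line (fun t => (ξ t).base.line) (fun t => (ξ t).toTangent) := by
  refine ⟨h.hasVelocityField, h.isParallelAlong, hx, hy, fun δ W hW hδ0 hδ1 => ?_⟩
  rw [h.curveLength_eq fun _ _ => rfl]
  exact hW.arccos_le_curveLength hδ0 hδ1

/-- Every shortest geodesic lifts to the great circle from `x` to the representative of `y` that is
in phase with `x`. -/
theorem IsShortestGeodesic.exists_lift (hρ : ρ = inner ℂ (x : CVec n) (y : CVec n))
    (hρ0 : ρ ≠ 0) {γ : ℝ → Gr1 n} {V : ℝ → TGr1 n}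
    (h : IsShortestGeodesic x.line y.line γ V) :
    ∃ ξ : ℝ → HorizVec n, IsGeodesicLift ξ (Real.arccos ‖ρ‖) ∧ (ξ 0).base = x ∧
      ((ξ 1).base : CVec n) = (conj ρ / (‖ρ‖ : ℂ)) • (y : CVec n) ∧
      V 0 = (ξ 0).toTangent ∧ V 1 = (ξ 1).toTangent := by
  obtain ⟨hV, hp, h0, h1, hmin⟩ := h
  obtain ⟨ξ, ω, hξ, hx, hγ⟩ := exists_isGeodesicLift hV hp h0
  obtain ⟨ζ, hζ, hζ0, hζ1⟩ := exists_isGeodesicLift_arccos hρ hρ0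
  -- Minimality is used only here, against the explicit great circle `ζ`.
  have hle : ω ≤ Real.arccos ‖ρ‖ := by
    rw [← hξ.curveLength_eq fun t ht => (hγ t ht).2, ← hζ.curveLength_eq fun _ _ => rfl]
    refine hmin _ _ hζ.hasVelocityField (by rw [hζ0]) ?_
    exact UnitVec.line_eq_line_iff.2 ⟨_, norm_conj_div_norm hρ0, hζ1⟩
  have hpi := Real.arccos_le_pi_div_two.2 (norm_nonneg ρ)
  obtain ⟨rfl, hy⟩ := hξ.eq_arccos (hle.trans hpi) hρ hρ0 hx
    ((hγ 1 (by simp)).1.trans h1)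
  exact ⟨ξ, hξ, hx, hy, (hγ 0 (by simp)).2, (hγ 1 (by simp)).2⟩

end Phase

end

/-! ### The transport formula. -/

theorem lemma3 (n : ℕ) (x y : UnitVec n) (ρ : ℂ) (d : ℝ)
    (hρ : ρ = inner ℂ (x : CVec n) (y : CVec n)) (hρ0 : ρ ≠ 0)
    (hd : d = Real.sqrt (1 - ‖ρ‖ ^ 2)) :
    (∃! e : TGr1 n, IsTangentFromTo x.line y.line e) ∧
    ∃ η : HorizVec n,
      η.base.line = y.line ∧
      (η.base : CVec n) = (conj ρ / (‖ρ‖ : ℂ)) • (y : CVec n) ∧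
      η.vec = ((Real.arctan (d / ‖ρ‖) / d : ℝ) : ℂ) •
        (conj ρ • (y : CVec n) - (x : CVec n)) ∧
      ∀ (γ : ℝ → Gr1 n) (V : ℝ → TGr1 n), IsShortestGeodesic x.line y.line γ V →
        ∀ f : TGr1 n, IsParallelTransport γ (V 0) f ↔ f = η.toTangent := by
  obtain ⟨ζ, hζ, hζ0, hζ1⟩ := exists_isGeodesicLift_arccos hρ hρ0
  have hline : (ζ 1).base.line = y.line :=
    UnitVec.line_eq_line_iff.2 ⟨_, norm_conj_div_norm hρ0, hζ1⟩
  have hpi : Real.arccos ‖ρ‖ < Real.pi := by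
    linarith [Real.arccos_le_pi_div_two.2 (norm_nonneg ρ), Real.pi_pos]
  have hle : ‖ρ‖ ≤ 1 := by
    rw [hρ]
    simpa using norm_inner_le_norm (𝕜 := ℂ) (x : CVec n) (y : CVec n)
  have hshort := IsGeodesicLift.isShortestGeodesic (x := x) (y := y) (ξ := ζ)
    (by rwa [← hρ]) (by rw [hζ0]) hline
  -- The lift of any shortest geodesic has the endpoints and speed of `ζ`; below speed `π` these
  -- determine both end velocities.
  have huniq : ∀ {γ : ℝ → Gr1 n} {V : ℝ → TGr1 n}, IsShortestGeodesic x.line y.line γ V →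
      V 0 = (ζ 0).toTangent ∧ V 1 = (ζ 1).toTangent := by
    intro γ V h
    obtain ⟨ξ, hξ, hξ0, hξ1, hV0, hV1⟩ := h.exists_lift hρ hρ0
    have e0 : ((ξ 0).base : CVec n) = (ζ 0).base := by rw [hξ0, hζ0]
    have e1 : ((ξ 1).base : CVec n) = (ζ 1).base := by rw [hξ1, hζ1]
    rw [hV0, hV1]
    exact ⟨congrArg _ (HorizVec.ext_of_coe e0
        (by rw [hξ.vec_zero_eq hpi, hζ.vec_zero_eq hpi, e0, e1])),
      congrArg _ (HorizVec.ext_of_coe e1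
        (by rw [hξ.vec_one_eq hpi, hζ.vec_one_eq hpi, e0, e1]))⟩
  refine ⟨⟨(ζ 0).toTangent, ⟨_, _, hshort, rfl⟩, ?_⟩, ζ 1, hline, hζ1, ?_, ?_⟩
  · rintro e ⟨γ, V, h, rfl⟩
    exact (huniq h).1
  · have hn : (‖ρ‖ : ℂ) ≠ 0 := by simpa using hρ0
    -- Here `sin ω = d`, `cos ω = |ρ|` and `ω = arctan (d / |ρ|)`. Division by zero gives
    -- coefficient `0` when `d = 0`, as the convention requires.
    rw [hζ.vec_one_eq hpi, hζ1, hζ0, Real.sin_arccos, ← hd,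
      Real.cos_arccos (by linarith [norm_nonneg ρ]) hle,
      Real.arccos_eq_arctan (norm_pos_iff.2 hρ0), ← hd, Complex.coe_smul, ← Complex.coe_smul ‖ρ‖,
      smul_smul, mul_div_cancel₀ _ hn]
  · intro γ V h f
    constructor
    · rintro ⟨X, hX, hX0, rfl⟩
      rw [hX.eq_one_of_eq_zero h.2.1 hX0, (huniq h).2]
    · rintro rfl
      -- The velocity field of a geodesic is its own parallel transport.
      exact ⟨V, h.2.1, rfl, (huniq h).2⟩
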